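/- Let $f \ge 0$ be an integer and let $G=(V,E)$ be a finite simple undirected graph on $n$ nodes. Call $G$ $k$-connected if $|V|>k$ and deleting fewer than $k$ nodes never disconnects $G$. Consider deterministic protocols in the synchronous local broadcast model: in every round each node broadcasts a message, which is received identically and correctly by all of its neighbours, who know which neighbour sent it; the protocol may depend on the node and on the (commonly known) graph $G$. A fixed but unknown set of at most $f$ nodes is faulty; faulty nodes may behave arbitrarily, with full knowledge of the system and in coordination with each other, except that their messages too are broadcast to all their neighbours. If $G$ is $(\lfloor 3f/2\rfloor+1)$-connected and every node of $G$ has degree at least $2f$, then there is a protocol on $G$, with finitely many local states and finitely many messages, that solves Byzantine Consensus with at most $f$ faults: for all binary inputs, every set of at most $f$ faulty nodes and every behaviour of the faulty nodes, 1. (Agreement) all non-faulty nodes output the same binary value; 2. (Validity) the output of each non-faulty node is the input of some non-faulty node; 3. (Termination) every non-faulty node irrevocably decides on its output in finite time; more precisely, after at most $n\sum_{i=0}^{f}\binom{n}{i}$ rounds. -/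

import Mathlib

universe u

namespace LocalBroadcast

variable {V : Type u}

/-- `G` is `k`-connected: it has more than `k` vertices, and deleting fewer than `k` vertices
never disconnects it. -/
def IsKConnected [Fintype V] (G : SimpleGraph V) (k : ℕ) : Prop :=
  k < Fintype.card V ∧
    ∀ S : Finset V, S.card < k → (G.induce {v : V | v ∉ S}).Connected

/-- A deterministic synchronous protocol on the graph `G` under local broadcast.
In every round each node broadcasts at most one message (`none` is silence), the same one for all
its neighbours, and then updates its state from what its neighbours broadcast in this round; the
argument of `step` is indexed by the neighbours, so a receiver knows who sent what.
All functions may depend on the node and, as the protocol is chosen for `G`, on the topology.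
State space and message alphabet are finite, so a protocol is a finite table (an algorithm);
a transmission outside of the alphabet counts as silence. -/
structure Protocol (G : SimpleGraph V) where
  State : Type u
  Msg : Type u
  finite_state : Finite State
  finite_msg : Finite Msg
  /-- the initial state of a node with a given binary input -/
  init : V → Bool → State
  /-- the message that a node broadcasts in a round -/
  send : V → State → Option Msg
  /-- the state of a node after a round -/
  step : (v : V) → State → (G.neighborSet v → Option Msg) → State
  /-- the decision of a node, `none` as long as it is undecided -/
  output : V → State → Option Bool

namespace Protocol

variable {G : SimpleGraph V}

open Classical in
/-- What node `w` broadcasts in a round: a node of the faulty set `T` broadcasts whatever the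
adversary chooses, any other node follows the protocol. -/
noncomputable def broadcast (P : Protocol G) (T : Finset V) (a : V → Option P.Msg)
    (s : V → P.State) (w : V) : Option P.Msg :=
  if w ∈ T then a w else P.send w (s w)

/-- The states of the nodes after `t` rounds, in the execution with faulty set `T`, inputs `x`,
and adversarial broadcasts `adv t w` (round `t`, node `w ∈ T`). The protocol is deterministic, so
ranging over all `adv` covers every adversary, also one that knows the whole system and reacts to
it. The states of nodes in `T` are never used. -/
noncomputable def state (P : Protocol G) (T : Finset V) (x : V → Bool)
    (adv : ℕ → V → Option P.Msg) : ℕ → V → P.State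
  | 0, v => P.init v (x v)
  | t + 1, v => P.step v (P.state T x adv t v)
      (fun w : G.neighborSet v => P.broadcast T (adv t) (P.state T x adv t) w)

/-- The decision (if any) of node `v` after `t` rounds. -/
noncomputable def decision (P : Protocol G) (T : Finset V) (x : V → Bool)
    (adv : ℕ → V → Option P.Msg) (t : ℕ) (v : V) : Option Bool :=
  P.output v (P.state T x adv t v)

/-- The execution with faulty set `T`, inputs `x` and adversary `adv` satisfies the conditions of
Byzantine Consensus, with all decisions made within `R` rounds. -/
structure ReachesConsensus (P : Protocol G) (T : Finset V) (x : V → Bool)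
    (adv : ℕ → V → Option P.Msg) (R : ℕ) : Prop where
  /-- every non-faulty node decides, within `R` rounds -/
  termination : ∀ v, v ∉ T → ∃ t ≤ R, ∃ b, P.decision T x adv t v = some b
  /-- a decision is final -/
  irrevocable : ∀ v, v ∉ T → ∀ t t' b, t ≤ t' →
    P.decision T x adv t v = some b → P.decision T x adv t' v = some b
  /-- any two non-faulty nodes decide on the same value -/
  agreement : ∀ v w, v ∉ T → w ∉ T → ∀ t t' b b',
    P.decision T x adv t v = some b → P.decision T x adv t' w = some b' → b = b'
  /-- the decision of a non-faulty node is the input of some non-faulty node -/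
  validity : ∀ v, v ∉ T → ∀ t b, P.decision T x adv t v = some b → ∃ w, w ∉ T ∧ x w = b

/-- `P` solves Byzantine Consensus with at most `f` faults, within `R` rounds: for every set of at
most `f` faulty nodes, all inputs, and every behaviour of the faulty nodes. -/
def SolvesByzantineConsensus (P : Protocol G) (f R : ℕ) : Prop :=
  ∀ T : Finset V, T.card ≤ f → ∀ (x : V → Bool) (adv : ℕ → V → Option P.Msg),
    P.ReachesConsensus T x adv R

end Protocol

end LocalBroadcast

/-!
The protocol runs one phase of `n` rounds for each set `F` of at most `f` nodes, the suspects of the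
phase. A node carries a current bit, initially its input. In a phase the bits are flooded
along all paths: in round `r` every node relays what it received along paths of length `r`. Since
transmissions are broadcast, a faulty node too announces a single bit at the start of the phase, and
this *announced* bit is what arrives over every path whose interior is fault-free
(`floodProtocol_table_eq`).

At the end of a phase, node `v` reads one path from every node, with interior outside `F`, and
computes from the bits read a favoured bit `δ` (`favoured`). It adopts `δ` if this is certified
(`Certified`): whichever set `S` of at most `f` other nodes is removed, `δ` has been received over a
path that avoids `S`. Asking for this rather than for `f + 1` disjoint paths makes an appeal to
Menger's theorem unnecessary.

* Taking for `S` the faulty set `T`, a certified bit was the bit of a non-faulty node; hence a phase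
  never introduces a new bit among the non-faulty nodes (`floodProtocol_safety`).
* In the phase with `F = T` all non-faulty nodes read the same announced bits, and so have the same
  `δ`. The rule for `δ` guarantees (`favoured_spec`) that either at most `f` nodes announced the
  other bit, so that the degree bound yields paths of length one, or more than `f` nodes announced
  `δ` and at most `f / 2` faulty nodes the other bit, so that connectivity yields the paths, after
  removal of these faulty nodes and `S` (`exists_path_of_colour_class`). So all
  non-faulty nodes hold `δ` after this phase (`floodProtocol_agreement`), and by the first point for
  ever after.
-/

namespace LocalBroadcast

open SimpleGraph

variable {V : Type u}

/-! ### Paths in highly connected graphs -/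

lemma exists_walk_first_hit {G : SimpleGraph V} (A : Set V) {v w : V} (p : G.Walk v w)
    (hw : w ∈ A) :
    ∃ u ∈ A, ∃ q : G.Walk v u, ∀ x ∈ q.support, x ∈ p.support ∧ (x ∈ A → x = u) := by
  induction p with
  | nil => exact ⟨_, hw, .nil, by simp⟩
  | @cons a b c h p ih =>
    by_cases ha : a ∈ A
    · exact ⟨a, ha, .nil, by simp⟩
    · obtain ⟨u, hu, q, hq⟩ := ih hw
      refine ⟨u, hu, .cons h q, fun x hx => ?_⟩
      rw [Walk.support_cons, List.mem_cons] at hx ⊢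
      rcases hx with rfl | hx
      · exact ⟨.inl rfl, fun h => absurd h ha⟩
      · exact ⟨.inr (hq x hx).1, (hq x hx).2⟩

lemma IsKConnected.exists_walk [Fintype V] {G : SimpleGraph V} {k : ℕ} (hG : IsKConnected G k)
    {S : Finset V} (hS : S.card < k) {v w : V} (hv : v ∉ S) (hw : w ∉ S) :
    ∃ p : G.Walk v w, ∀ x ∈ p.support, x ∉ S := by
  obtain ⟨p⟩ := (hG.2 S hS).preconnected ⟨v, hv⟩ ⟨w, hw⟩
  refine ⟨p.map (Embedding.induce {v : V | v ∉ S}).toHom, fun x hx => ?_⟩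
  replace hx := List.mem_map.1 ((Walk.support_map _ p) ▸ hx)
  obtain ⟨y, -, rfl⟩ := hx
  exact y.2

open Classical in
lemma IsKConnected.exists_path_avoiding [Fintype V] {G : SimpleGraph V} {k : ℕ}
    (hG : IsKConnected G k) {F : Finset V} (hF : F.card < k) (v w : V) :
    ∃ p : G.Walk v w, p.IsPath ∧ ∀ x ∈ p.support, x ≠ v → x ≠ w → x ∉ F := by
  obtain ⟨p, hp⟩ := hG.exists_walk (S := (F.erase v).erase w) (v := v) (w := w)
    (lt_of_le_of_lt (Finset.card_le_card fun x hx => by simp_all) hF) (by simp) (by simp)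
  exact ⟨p.bypass, p.bypass_isPath, fun x hx hv hw hxF =>
    hp x (p.support_bypass_subset_support hx) (by simp [*])⟩

open Classical in
/-- A node `v` outside a large class `A` cannot be separated from `A` by `f` nodes, even if only
paths with interior outside the faulty set `T` are allowed. Nodes of `A ∩ T` are harmless, as
a path can be cut off at its first node in `A`. -/
lemma exists_path_of_colour_class [Fintype V] {G : SimpleGraph V} [DecidableRel G.Adj] {f : ℕ}
    (hconn : IsKConnected G (3 * f / 2 + 1)) (hdeg : ∀ v : V, 2 * f ≤ G.degree v)
    {T A S : Finset V} {v : V} (hvT : v ∉ T) (hvA : v ∉ A) (hvS : v ∉ S) (hS : S.card ≤ f)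
    (hA : (f < A.card ∧ (T \ A).card ≤ f / 2) ∨ Aᶜ.card ≤ f) :
    ∃ u ∈ A, ∃ p : G.Walk v u, p.IsPath ∧ (∀ x ∈ p.support, x ∉ S) ∧
      ∀ x ∈ p.support, x ≠ v → x ≠ u → x ∉ T := by
  rcases hA with ⟨hA, hTA⟩ | hA
  · obtain ⟨w, hwA, hwS⟩ := Finset.exists_mem_notMem_of_card_lt_card (hS.trans_lt hA)
    have hcard : (S ∪ T \ A).card < 3 * f / 2 + 1 := by
      have := Finset.card_union_le S (T \ A)
      omega
    obtain ⟨p, hp⟩ := hconn.exists_walk hcard (v := v) (w := w) (by simp [*]) (by simp [*])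
    obtain ⟨u, hu, q, hq⟩ := exists_walk_first_hit (A : Set V) p hwA
    refine ⟨u, hu, q.bypass, q.bypass_isPath, fun x hx hxS => ?_, fun x hx _ hxu hxT => ?_⟩
    · exact hp x (hq x (q.support_bypass_subset_support hx)).1 (by simp [hxS])
    · have := hq x (q.support_bypass_subset_support hx)
      refine hp x this.1 ?_
      simp only [Finset.mem_union, Finset.mem_sdiff]
      exact .inr ⟨hxT, fun h => hxu (this.2 h)⟩
  · have hvA' : v ∈ Aᶜ := by simpa using hvA
    obtain ⟨u, huN, hu⟩ : ∃ u ∈ G.neighborFinset v, u ∉ Aᶜ.erase v ∪ S := by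
      refine Finset.exists_mem_notMem_of_card_lt_card ?_
      have h1 := Finset.card_union_le (Aᶜ.erase v) S
      have h2 := Finset.card_erase_add_one hvA'
      have h3 := hdeg v
      rw [G.card_neighborFinset_eq_degree]
      omega
    have hadj : G.Adj v u := by simpa using huN
    simp only [Finset.mem_union, Finset.mem_erase, Finset.mem_compl, not_or, not_and,
      not_not] at hu
    refine ⟨u, hu.1 hadj.ne', hadj.toWalk, ?_, ?_, ?_⟩
    · simpa using hadj.ne
    · simp [hvS, hu.2]
    · simp only [Adj.toWalk, Walk.support_cons, Walk.support_nil, List.mem_cons]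
      simp +contextual

/-! ### The protocol -/

/-- A list of distinct nodes, standing for a way that a bit can travel towards a receiver: the last
entry is the origin, the first one is the neighbour which delivers the bit. The receiver
itself is not listed. Adjacency of consecutive entries is not required. -/
abbrev Route (V : Type u) : Type u := {l : List V // l.Nodup}

/-- The route over which a bit reaches the node `v` from `u`, along the path `p` that is traversed
backwards. -/
def route {G : SimpleGraph V} {v u : V} (p : G.Walk v u) (hp : p.IsPath) : Route V :=
  ⟨p.support.tail, hp.support_nodup.tail⟩

open Classical in
/-- The bit that `v`, whose own bit is `b`, reads from `u` in a table `K` of received bits, in the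
phase with suspects `F`: the one received over some fixed path with interior outside `F`, if
there is such a path. -/
noncomputable def reading (G : SimpleGraph V) (F : Finset V) (v : V) (b : Bool)
    (K : Route V → Bool) (u : V) : Bool :=
  if u = v then b
  else if h : ∃ p : G.Walk v u, p.IsPath ∧ ∀ x ∈ p.support, x ≠ v → x ≠ u → x ∉ F then
    K (route h.choose h.choose_spec.1)
  else false

open Classical in
/-- The bit towards which nodes move in the phase with suspects `F`, when `σ u` is the bit of `u`.
It is a bit for which at most `f / 2` suspects have the opposite one, unless at most `f` nodes
have it; then it is the opposite one. -/
noncomputable def favoured [Fintype V] (f : ℕ) (F : Finset V) (σ : V → Bool) : Bool :=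
  if (F.filter fun u => σ u = false).card ≤ f / 2 then
    decide (f < (Finset.univ.filter fun u => σ u = true).card)
  else decide ((Finset.univ.filter fun u => σ u = false).card ≤ f)

/-- The bit `δ` has reached `v`, according to its table `K`, over paths that no `f` nodes other than
`v` can block. A blocking node may be the origin of a path. -/
def Certified (G : SimpleGraph V) (f : ℕ) (v : V) (K : Route V → Bool) (δ : Bool) : Prop :=
  ∀ S : Finset V, S.card ≤ f → v ∉ S → ∃ (u : V) (p : G.Walk v u) (hp : p.IsPath),
    ¬ p.Nil ∧ (∀ x ∈ p.support, x ∉ S) ∧ K (route p hp) = δ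

open Classical in
/-- The bit of `v` after a phase with suspects `F`, if its bit was `b` and the flooding left it with
the table `K`. -/
noncomputable def newBit [Fintype V] (G : SimpleGraph V) (f : ℕ) (F : Finset V) (v : V) (b : Bool)
    (K : Route V → Bool) : Bool :=
  if Certified G f v K (favoured f F (reading G F v b K)) then favoured f F (reading G F v b K)
  else b

open Classical in
/-- The set of suspects in phase `i`, from an enumeration of the sets of at most `f` nodes. The
value for `i` beyond the number of these sets does not matter. -/
noncomputable def suspects (V : Type u) [Fintype V] (f i : ℕ) : Finset V :=
  ((Finset.univ.filter fun F : Finset V => F.card ≤ f).toList[i]?).getD ∅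

/-- The number of phases. -/
def phases (V : Type u) [Fintype V] (f : ℕ) : ℕ :=
  ∑ i ∈ Finset.range (f + 1), (Fintype.card V).choose i

open Classical in
lemma exists_suspects_eq [Fintype V] {f : ℕ} {T : Finset V} (hT : T.card ≤ f) :
    ∃ i < phases V f, suspects V f i = T := by
  have hmem : T ∈ (Finset.univ.filter fun F : Finset V => F.card ≤ f).toList := by simpa
  obtain ⟨i, hi, h⟩ := List.getElem_of_mem hmem
  refine ⟨i, ?_, by simp [suspects, List.getElem?_eq_getElem hi, h]⟩
  have hc : (Finset.univ.filter fun F : Finset V => F.card ≤ f).card = phases V f := by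
    rw [phases, Finset.card_eq_sum_card_fiberwise (f := Finset.card) (t := Finset.range (f + 1))
      (fun F hF => by simpa [Nat.lt_succ_iff] using hF)]
    refine Finset.sum_congr rfl fun i hi => ?_
    rw [← Finset.card_univ, ← Finset.card_powersetCard]
    congr 1
    ext F
    simp only [Finset.mem_range] at hi
    simp only [Finset.mem_filter, Finset.mem_univ, true_and, Finset.mem_powersetCard,
      Finset.subset_univ]
    omega
  rw [← hc, ← Finset.length_toList]
  exact hi

/-- The state of a node: the number of elapsed rounds (stopping at the last one), the current bit,
and the table of received bits. -/
@[ext]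
structure FloodState (V : Type u) (R : ℕ) : Type u where
  clock : Fin (R + 1)
  bit : Bool
  table : Route V → Bool

instance [Finite V] (R : ℕ) : Finite (FloodState V R) := by
  classical
  have := Fintype.ofFinite V
  refine Finite.of_injective (β := Fin (R + 1) × Bool × (Route V → Bool))
    (fun s => (s.clock, s.bit, s.table)) fun s t h => ?_
  simp only [Prod.mk.injEq] at h
  exact FloodState.ext h.1 h.2.1 h.2.2

open Classical in
/-- The table `K` of `v` after it received the messages `m` in round `r` of a phase. Only
entries for routes of length `r + 1` are overwritten, so that each entry is written once per phase;
this keeps a faulty node from replacing what it announced. Silence counts as `false`. -/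
noncomputable def updateTable (G : SimpleGraph V) (v : V) (r : ℕ) (K : Route V → Bool)
    (m : G.neighborSet v → Option (Route V → Bool)) (π : Route V) : Bool :=
  if h : ∃ w : G.neighborSet v, π.1.head? = some w.1 ∧ π.1.length = r + 1 then
    ((m h.choose).getD fun _ => false) π
  else K π

lemma updateTable_of_adj {G : SimpleGraph V} {v w : V} (h : G.Adj v w) {r : ℕ}
    (K : Route V → Bool) (m : G.neighborSet v → Option (Route V → Bool)) {π : Route V}
    (hw : π.1.head? = some w) (hr : π.1.length = r + 1) :
    updateTable G v r K m π = ((m ⟨w, h⟩).getD fun _ => false) π := by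
  have hex : ∃ w : G.neighborSet v, π.1.head? = some w.1 ∧ π.1.length = r + 1 :=
    ⟨⟨w, h⟩, hw, hr⟩
  rw [updateTable, dif_pos hex]
  have : hex.choose = ⟨w, h⟩ :=
    Subtype.ext (Option.some_injective _ (hex.choose_spec.1.symm.trans hw))
  rw [this]

lemma updateTable_of_length_ne {G : SimpleGraph V} {v : V} {r : ℕ}
    (K : Route V → Bool) (m : G.neighborSet v → Option (Route V → Bool)) {π : Route V}
    (hr : π.1.length ≠ r + 1) : updateTable G v r K m π = K π :=
  dif_neg fun ⟨_, h⟩ => hr h.2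

open Classical in
/-- The protocol: in each phase bits are flooded over all routes, and after the last round of the
phase every node updates its bit. A node broadcasts, for each route, the bit it received over the
route without its first entry, which is meant to be the node itself; if nothing remains, it
announces its own bit. -/
noncomputable def floodProtocol [Fintype V] (G : SimpleGraph V) (f : ℕ) : Protocol G where
  State := FloodState V (Fintype.card V * phases V f)
  Msg := Route V → Bool
  finite_state := inferInstance
  finite_msg := inferInstance
  init _ b := ⟨0, b, fun _ => false⟩
  send _ s := some fun π => if π.1.tail = [] then s.bit else s.table ⟨π.1.tail, π.2.tail⟩
  step v s m :=
    if h : s.clock.1 < Fintype.card V * phases V f then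
      { clock := ⟨s.clock.1 + 1, by omega⟩
        bit :=
          if s.clock.1 % Fintype.card V + 1 = Fintype.card V then
            newBit G f (suspects V f (s.clock.1 / Fintype.card V)) v s.bit
              (updateTable G v (s.clock.1 % Fintype.card V) s.table m)
          else s.bit
        table := updateTable G v (s.clock.1 % Fintype.card V) s.table m }
    else s
  output _ s := if s.clock.1 = Fintype.card V * phases V f then some s.bit else none

/-! ### Flooding in a phase -/

section Execution

variable [Fintype V] (G : SimpleGraph V) (f : ℕ) (T : Finset V) (x : V → Bool)
  (adv : ℕ → V → Option (Route V → Bool))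

/-- The states in the execution of `floodProtocol`. -/
noncomputable abbrev floodState (t : ℕ) (v : V) : FloodState V (Fintype.card V * phases V f) :=
  (floodProtocol G f).state T x adv t v

/-- The messages in the execution of `floodProtocol`. -/
noncomputable abbrev floodMsg (t : ℕ) (w : V) : Option (Route V → Bool) :=
  (floodProtocol G f).broadcast T (adv t) ((floodProtocol G f).state T x adv t) w

open Classical in
/-- The bit that `u` announces in phase `i`: its current bit if it is non-faulty, else what the
adversary makes it broadcast in the first round of the phase. -/
noncomputable def announced (i : ℕ) (u : V) : Bool :=
  if u ∈ T then ((adv (Fintype.card V * i) u).getD fun _ => false) ⟨[u], by simp⟩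
  else (floodState G f T x adv (Fintype.card V * i) u).bit

lemma floodState_clock (t : ℕ) (v : V) :
    (floodState G f T x adv t v).clock.1 = min t (Fintype.card V * phases V f) := by
  induction t with
  | zero => simp [floodState, Protocol.state, floodProtocol]
  | succ t ih =>
    by_cases h : (floodState G f T x adv t v).clock.1 < Fintype.card V * phases V f
    · have hstep : floodState G f T x adv (t + 1) v = _ := dif_pos h
      have : (floodState G f T x adv (t + 1) v).clock.1 =
          (floodState G f T x adv t v).clock.1 + 1 := by rw [hstep]
      omega
    · have hstep : floodState G f T x adv (t + 1) v = floodState G f T x adv t v := dif_neg h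
      rw [hstep]
      omega

lemma floodState_of_le {t : ℕ} (ht : Fintype.card V * phases V f ≤ t) (v : V) :
    floodState G f T x adv t v = floodState G f T x adv (Fintype.card V * phases V f) v := by
  induction t, ht using Nat.le_induction with
  | base => rfl
  | succ t ht ih =>
    rw [← ih]
    have h := floodState_clock G f T x adv t v
    rw [min_eq_right ht] at h
    exact dif_neg (by rw [h]; exact lt_irrefl _)

variable {G f T x adv} in
lemma floodState_succ {i r : ℕ} (hi : i < phases V f) (hr : r < Fintype.card V) (v : V) :
    (floodState G f T x adv (Fintype.card V * i + r + 1) v).table =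
      updateTable G v r (floodState G f T x adv (Fintype.card V * i + r) v).table
        (fun w => floodMsg G f T x adv (Fintype.card V * i + r) w) ∧
    (floodState G f T x adv (Fintype.card V * i + r + 1) v).bit =
      if r + 1 = Fintype.card V then
        newBit G f (suspects V f i) v (floodState G f T x adv (Fintype.card V * i + r) v).bit
          (floodState G f T x adv (Fintype.card V * i + r + 1) v).table
      else (floodState G f T x adv (Fintype.card V * i + r) v).bit := by
  have hlt : Fintype.card V * i + r < Fintype.card V * phases V f := by
    have : Fintype.card V * (i + 1) ≤ Fintype.card V * phases V f := Nat.mul_le_mul_left _ hi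
    rw [mul_add] at this
    omega
  have hclock := floodState_clock G f T x adv (Fintype.card V * i + r) v
  rw [min_eq_left hlt.le] at hclock
  have hmod : (Fintype.card V * i + r) % Fintype.card V = r := by
    rw [Nat.mul_add_mod, Nat.mod_eq_of_lt hr]
  have hdiv : (Fintype.card V * i + r) / Fintype.card V = i := by
    rw [Nat.mul_add_div (by omega), Nat.div_eq_of_lt hr, add_zero]
  have hstep : floodState G f T x adv (Fintype.card V * i + r + 1) v = _ :=
    dif_pos (hclock.trans_lt hlt)
  rw [hstep]
  simp only [hclock, hmod, hdiv, and_self]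

variable {G f T x adv} in
lemma floodState_bit_of_lt {i : ℕ} (hi : i < phases V f) (v : V) {r : ℕ}
    (hr : r < Fintype.card V) :
    (floodState G f T x adv (Fintype.card V * i + r) v).bit =
      (floodState G f T x adv (Fintype.card V * i) v).bit := by
  induction r with
  | zero => rfl
  | succ r ih => rw [← add_assoc, (floodState_succ hi (by omega) v).2, if_neg hr.ne, ih (by omega)]

/-- After `s` rounds of a phase, the announced bit of `u` is received over every path of length
at most `s` with fault-free interior. -/
lemma floodProtocol_table_eq {i : ℕ} (hi : i < phases V f) {s : ℕ} (hs : s ≤ Fintype.card V)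
    {v u : V} (p : G.Walk v u) (hp : p.IsPath) (hnil : ¬ p.Nil) (hlen : p.length ≤ s)
    (hT : ∀ y ∈ p.support, y ≠ v → y ≠ u → y ∉ T) :
    (floodState G f T x adv (Fintype.card V * i + s) v).table (route p hp) =
      announced G f T x adv i u := by
  induction s generalizing v with
  | zero => exact absurd (Walk.length_eq_zero_iff.1 (Nat.le_zero.1 hlen)) hnil
  | succ s ih =>
    rw [← add_assoc, (floodState_succ hi hs v).1]
    rcases hlen.lt_or_eq with hlt | heq
    · rw [updateTable_of_length_ne, ih (by omega) p hp hnil (by omega) hT]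
      simp only [route, List.length_tail, Walk.length_support]
      omega
    · cases p with
      | nil => simp at hnil
      | @cons _ w _ h q =>
        rw [updateTable_of_adj h _ _ (w := w)]
        · have hq : q.IsPath := hp.of_cons
          by_cases hqn : q.Nil
          · -- a path of length one: the bit arrives from its origin, in the first round
            cases q with
            | cons => simp at hqn
            | nil =>
              obtain rfl : s = 0 := by simpa using heq.symm
              by_cases hu : u ∈ T
              · simp [floodMsg, Protocol.broadcast, announced, hu, route]
              · simp [floodMsg, Protocol.broadcast, announced, hu, route, floodProtocol,
                  floodState]
          · have hwu : w ≠ u := by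
              rintro rfl
              exact hqn (Walk.isPath_iff_nil.1 hq)
            have hvq : v ∉ q.support := ((Walk.cons_isPath_iff _ _).1 hp).2
            have hw : w ∉ T := hT w (by simp) h.ne' hwu
            have hih := ih (v := w) (by omega) q hq hqn (by simp at heq; omega)
              fun y hy _ hyu => hT y (by simp [hy]) (fun e => hvq (e ▸ hy)) hyu
            rw [← hih]
            have hne : q.support.tail ≠ [] := by
              intro e
              have h1 : q.support.tail.length = 0 := by rw [e]; rfl
              have h2 : q.length = 0 := by simpa using h1
              exact hqn (Walk.length_eq_zero_iff.1 h2)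
            simp [floodMsg, Protocol.broadcast, hw, route, floodProtocol, hne, floodState]
        · simp only [route, Walk.support_cons, List.tail_cons]
          rw [← Walk.cons_tail_support]
          rfl
        · simpa [route] using heq

/-! ### The effect of a phase -/

variable {G f T x adv} in
lemma floodState_bit_next_phase [Nonempty V] {i : ℕ} (hi : i < phases V f) (v : V) :
    (floodState G f T x adv (Fintype.card V * (i + 1)) v).bit =
      newBit G f (suspects V f i) v (floodState G f T x adv (Fintype.card V * i) v).bit
        (floodState G f T x adv (Fintype.card V * i + Fintype.card V) v).table := by
  obtain ⟨r, hr⟩ := Nat.exists_eq_add_of_lt (Fintype.card_pos (α := V))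
  rw [zero_add] at hr
  have h := (floodState_succ (G := G) (T := T) (x := x) (adv := adv) hi (r := r) (by omega) v).2
  rw [if_pos hr.symm, floodState_bit_of_lt hi v (by omega), add_assoc, ← hr] at h
  rw [mul_add, mul_one, h]

variable {G f T x adv} in
/-- A phase does not introduce a bit that no non-faulty node had. -/
lemma floodProtocol_safety [Nonempty V] (hT : T.card ≤ f) {i : ℕ} (hi : i < phases V f) {v : V}
    (hv : v ∉ T) :
    ∃ w ∉ T, (floodState G f T x adv (Fintype.card V * (i + 1)) v).bit =
      (floodState G f T x adv (Fintype.card V * i) w).bit := by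
  rw [floodState_bit_next_phase hi, newBit]
  split_ifs with h
  · obtain ⟨u, p, hp, hnil, hpT, hK⟩ := h T hT hv
    have hu : u ∉ T := hpT u p.end_mem_support
    refine ⟨u, hu, ?_⟩
    rw [← hK, floodProtocol_table_eq G f T x adv hi le_rfl p hp hnil hp.length_lt.le
      fun y hy _ _ => hpT y hy, announced, if_neg hu]
  · exact ⟨v, hv, rfl⟩

open Classical in
lemma favoured_spec {f : ℕ} {T : Finset V} (hT : T.card ≤ f) (σ : V → Bool) :
    let A := Finset.univ.filter fun u => σ u = favoured f T σ
    (f < A.card ∧ (T \ A).card ≤ f / 2) ∨ Aᶜ.card ≤ f := by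
  have hsplit := Finset.card_filter_add_card_filter_not (s := T) (fun u => σ u = false)
  have hdiff : ∀ b, T \ (Finset.univ.filter fun u => σ u = b) = T.filter fun u => ¬ σ u = b :=
    fun b => by ext; simp
  have hcompl : ∀ b, (Finset.univ.filter fun u => σ u = b)ᶜ =
      Finset.univ.filter fun u => ¬ σ u = b := fun b => by ext; simp
  simp only [hdiff, hcompl]
  simp only [Bool.not_eq_false] at hsplit
  rw [favoured]
  split_ifs with h1
  · by_cases h2 : f < (Finset.univ.filter fun u => σ u = true).card
    · simp only [h2, decide_true, Bool.not_eq_true]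
      exact .inl ⟨trivial, h1⟩
    · simp only [h2, decide_false, Bool.not_eq_false]
      exact .inr (not_lt.1 h2)
  · by_cases h2 : (Finset.univ.filter fun u => σ u = false).card ≤ f
    · simp only [h2, decide_true, Bool.not_eq_true]
      exact .inr trivial
    · simp only [h2, decide_false, Bool.not_eq_false]
      exact .inl ⟨not_le.1 h2, by omega⟩

variable {G f T x adv} in
/-- In the phase whose suspects are the faulty nodes, all non-faulty nodes move to the same bit. -/
lemma floodProtocol_agreement [Nonempty V] [DecidableRel G.Adj]
    (hconn : IsKConnected G (3 * f / 2 + 1)) (hdeg : ∀ v : V, 2 * f ≤ G.degree v)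
    (hT : T.card ≤ f) {i : ℕ} (hi : i < phases V f) (hiT : suspects V f i = T) {v : V}
    (hv : v ∉ T) :
    (floodState G f T x adv (Fintype.card V * (i + 1)) v).bit =
      favoured f T (announced G f T x adv i) := by
  classical
  have hbit : (floodState G f T x adv (Fintype.card V * i) v).bit =
      announced G f T x adv i v := by rw [announced, if_neg hv]
  have hread : reading G T v (floodState G f T x adv (Fintype.card V * i) v).bit
      (floodState G f T x adv (Fintype.card V * i + Fintype.card V) v).table =
      announced G f T x adv i := by
    funext u
    rw [reading]
    split_ifs with h1 h2
    · rw [hbit, h1]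
    · exact floodProtocol_table_eq G f T x adv hi le_rfl _ h2.choose_spec.1
        (fun h => h1 h.eq.symm) h2.choose_spec.1.length_lt.le h2.choose_spec.2
    · exact absurd (hconn.exists_path_avoiding (by omega) v u) h2
  rw [floodState_bit_next_phase hi, hiT, newBit, hread]
  split_ifs with hc
  · rfl
  · by_contra hne
    refine hc fun S hS hvS => ?_
    obtain ⟨u, hu, p, hp, hpS, hpT⟩ := exists_path_of_colour_class hconn hdeg hv
      (A := Finset.univ.filter fun u => announced G f T x adv i u =
        favoured f T (announced G f T x adv i))
      (by simpa [← hbit] using hne) hvS hS (favoured_spec hT _)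
    rw [Finset.mem_filter] at hu
    have hnil : ¬ p.Nil := fun h => hne (by rw [hbit, h.eq, hu.2])
    exact ⟨u, p, hp, hnil, hpS, by
      rw [floodProtocol_table_eq G f T x adv hi le_rfl p hp hnil hp.length_lt.le hpT, hu.2]⟩

end Execution

end LocalBroadcast

open LocalBroadcast in
theorem theorem1 {V : Type u} [Fintype V] (G : SimpleGraph V) [DecidableRel G.Adj] (f : ℕ)
    (hconn : LocalBroadcast.IsKConnected G (3 * f / 2 + 1))
    (hdeg : ∀ v : V, 2 * f ≤ G.degree v) :
    ∃ P : LocalBroadcast.Protocol G,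
      P.SolvesByzantineConsensus f
        (Fintype.card V * ∑ i ∈ Finset.range (f + 1), (Fintype.card V).choose i) := by
  have : Nonempty V := Fintype.card_pos_iff.1 (by have := hconn.1; omega)
  refine ⟨floodProtocol G f, fun T hT x adv => ?_⟩
  change (floodProtocol G f).ReachesConsensus T x adv (Fintype.card V * phases V f)
  obtain ⟨i, hi, hiT⟩ := exists_suspects_eq hT
  have hagree : ∀ j, i + 1 ≤ j → j ≤ phases V f → ∀ v ∉ T,
      (floodState G f T x adv (Fintype.card V * j) v).bit =
        favoured f T (announced G f T x adv i) := by
    intro j hj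
    induction j, hj using Nat.le_induction with
    | base => exact fun _ v hv => floodProtocol_agreement hconn hdeg hT hi hiT hv
    | succ j _ ih =>
      intro hj v hv
      obtain ⟨w, hw, h⟩ := floodProtocol_safety (G := G) (x := x) (adv := adv) hT hj hv
      rw [h, ih (by omega) w hw]
  have hvalid : ∀ j ≤ phases V f, ∀ v ∉ T,
      ∃ w, w ∉ T ∧ x w = (floodState G f T x adv (Fintype.card V * j) v).bit := by
    intro j
    induction j with
    | zero => exact fun _ v hv => ⟨v, hv, rfl⟩
    | succ j ih =>
      intro hj v hv
      obtain ⟨w, hw, h⟩ := floodProtocol_safety (G := G) (x := x) (adv := adv) hT hj hv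
      rw [h]
      exact ih (by omega) w hw
  -- decisions are made exactly from the end of the last phase on
  have hdec : ∀ t v, (floodProtocol G f).decision T x adv t v =
      if Fintype.card V * phases V f ≤ t then
        some (floodState G f T x adv (Fintype.card V * phases V f) v).bit else none := by
    intro t v
    have hclock := floodState_clock G f T x adv t v
    split_ifs with h
    · rw [min_eq_right h] at hclock
      rw [← floodState_of_le G f T x adv h]
      exact if_pos hclock
    · rw [min_eq_left (by omega)] at hclock
      exact if_neg (by rw [hclock]; omega)
  have hsome : ∀ {t v b}, (floodProtocol G f).decision T x adv t v = some b →
      Fintype.card V * phases V f ≤ t ∧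
        (floodState G f T x adv (Fintype.card V * phases V f) v).bit = b := by
    intro t v b h
    rw [hdec] at h
    split_ifs at h with ht
    exact ⟨ht, Option.some_injective _ h⟩
  refine ⟨fun v _ => ⟨_, le_rfl, _, by rw [hdec, if_pos le_rfl]⟩, ?_, ?_, ?_⟩
  · intro v _ t t' b htt' h
    obtain ⟨ht, rfl⟩ := hsome h
    rw [hdec, if_pos (ht.trans htt')]
  · intro v w hv hw t t' b b' h h'
    rw [← (hsome h).2, ← (hsome h').2, hagree _ hi le_rfl v hv, hagree _ hi le_rfl w hw]
  · intro v hv t b h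
    obtain ⟨w, hw, hxw⟩ := hvalid _ le_rfl v hv
    exact ⟨w, hw, hxw.trans (hsome h).2⟩
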